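/- Let $p$ be a prime and let $f(z)\in\overline{\mathbb F}_p[z]$ be an additive polynomial ($f(x+y)=f(x)+f(y)$) that is separable and has degree at least $2$. Let $R$ be a discrete valuation ring of characteristic zero with fraction field $K$, together with a ring homomorphism $R\to\overline{\mathbb F}_p$ (for instance, $R$ has residue field $\overline{\mathbb F}_p$). Then $f$ does not admit a lift over $R$ which preserves the geometric iterated monodromy action. That is, there is no rational map $\tilde f\in K(z)$ such that 1. $\tilde f$ is a lift of $f$ over $R$: it extends to a morphism $\mathbb P^1_R\to\mathbb P^1_R$ (i.e. $\tilde f=P/Q$ with $P,Q\in R[z]$ whose reductions $\bar P,\bar Q\in\overline{\mathbb F}_p[z]$ are coprime and satisfy $\max(\deg\bar P,\deg\bar Q)=\max(\deg P,\deg Q)$), and its reduction $\bar P/\bar Q$ satisfies $\alpha\circ(\bar P/\bar Q)\circ\alpha^{-1}=f$ for some $\alpha\in\mathrm{PGL}_2(\overline{\mathbb F}_p)$; and 2. the action of $\mathrm{IMG}_{\overline K}(\tilde f)$ on $\mathcal O^-_{\tilde f}(T)$ is equivalent to the action of $\mathrm{IMG}_{\overline{\mathbb F}_p}(f)$ on $\mathcal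 O^-_f(t)$, whether or not the equivalence is induced by specialization. Here, for an algebraically closed field $F$, a rational map $g\in F(z)$ of degree at least $2$ with $g'\ne0$, and $t$ transcendental over $F$, $\mathcal O^-_g(t)=\bigcup_{n\ge1}g^{-n}(t)$ is the set of all $x$ in a fixed algebraic closure of $F(t)$ with $g^n(x)=t$ for some $n\ge1$, and $\mathrm{IMG}_F(g)=\mathrm{Gal}(K_\infty/F(t))$, where $K_\infty$ is generated over $F(t)$ by $\mathcal O_g^-(t)$. Actions of $G$ on $\Omega$ and of $G'$ on $\Omega'$ are equivalent if there are a group isomorphism $\phi:G\to G'$ and a bijection $\beta:\Omega\to\Omega'$ with $\beta(g\cdot\omega)=\phi(g)\cdot\beta(\omega)$ for all $g\in G$, $\omega\in\Omega$. -/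

import Mathlib

open Polynomial

noncomputable section

namespace IterMonodromy

universe u v

section Dynamics

variable {F : Type u} [Field F]

/-- Composition `f ∘ g` of rational maps (in the applications `g` is nonconstant, so that the
denominator of `f` does not vanish at `g`). -/
def comp (f g : RatFunc F) : RatFunc F := f.eval RatFunc.C g

/-- The iterates `f^n`, with `f^0 = z`. -/
def iter (f : RatFunc F) : ℕ → RatFunc F
  | 0 => RatFunc.X
  | n + 1 => comp f (iter f n)

/-- The Möbius transformation `(a z + b) / (c z + d)` of an invertible matrix. -/
def mobius (M : GL (Fin 2) F) : RatFunc F :=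
  (RatFunc.C (M.1 0 0) * RatFunc.X + RatFunc.C (M.1 0 1)) /
    (RatFunc.C (M.1 1 0) * RatFunc.X + RatFunc.C (M.1 1 1))

/-- Isomorphism of dynamical systems over `F`: `α ∘ g ∘ α⁻¹ = f` for some `α ∈ PGL₂(F)`. -/
def LinearlyConjugate (g f : RatFunc F) : Prop :=
  ∃ M : GL (Fin 2) F, comp (mobius M) g = comp f (mobius M)

variable (f : RatFunc F) (E : Type u) [Field E] [Algebra (RatFunc F) E]

/-- The fibre `f^{-n}(t)` in a field `E` containing `F(t)`: all `x` in `E` with `f^n(x) = t`.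
(A point at which the denominator of `f^n` vanishes gets the value `0 ≠ t`, and `f^n(∞)` is
in `ℙ¹(F)`, so poles and infinity do not matter.) -/
def fiber (n : ℕ) : Set E :=
  {x | (iter f n).eval ((algebraMap (RatFunc F) E).comp RatFunc.C) x =
    algebraMap (RatFunc F) E RatFunc.X}

/-- The backward orbit of `t` in `E`: the union of the fibres `f^{-n}(t)`, `n ≥ 1`. -/
def backwardOrbit : Set E := {x | ∃ n, 1 ≤ n ∧ x ∈ fiber f E n}

variable {E}

lemma map_mem_fiber_iff {E' : Type u} [Field E'] [Algebra (RatFunc F) E']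
    (σ : E →ₐ[RatFunc F] E') (n : ℕ) (x : E) :
    σ x ∈ fiber f E' n ↔ x ∈ fiber f E n := by
  have key : (iter f n).eval ((algebraMap (RatFunc F) E').comp RatFunc.C) (σ x) =
      σ ((iter f n).eval ((algebraMap (RatFunc F) E).comp RatFunc.C) x) := by
    have hc : (algebraMap (RatFunc F) E').comp RatFunc.C =
        (σ : E →+* E').comp ((algebraMap (RatFunc F) E).comp (RatFunc.C (K := F))) := by
      ext a; simp
    have h2 : σ x = (σ : E →+* E') x := rfl
    have h3 : ∀ y, σ y = (σ : E →+* E') y := fun _ => rfl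
    simp only [RatFunc.eval, h3, map_div₀, hc, Polynomial.hom_eval₂]
  simp only [fiber, Set.mem_ofPred_eq]
  rw [key, ← σ.commutes]
  exact σ.injective.eq_iff

lemma map_mem_backwardOrbit_iff {E' : Type u} [Field E'] [Algebra (RatFunc F) E']
    (σ : E →ₐ[RatFunc F] E') (x : E) :
    σ x ∈ backwardOrbit f E' ↔ x ∈ backwardOrbit f E := by
  simp only [backwardOrbit, Set.mem_ofPred_eq, map_mem_fiber_iff]

/-- `K_∞`: the extension of `F(t)` generated by all the fibres `f^{-n}(t)` in a fixed algebraic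
closure of `F(t)`. -/
def iterField : IntermediateField (RatFunc F) (AlgebraicClosure (RatFunc F)) :=
  IntermediateField.adjoin (RatFunc F) (backwardOrbit f (AlgebraicClosure (RatFunc F)))

/-- The iterated monodromy group `Gal(K_∞ / F(t))` of `f` over `F`. -/
abbrev IMG : Type u := iterField f ≃ₐ[RatFunc F] iterField f

/-- The backward orbit of `t`, on which the iterated monodromy group acts. It lies in `K_∞`,
by the definition of `K_∞`, and is regarded as a subset of it. -/
abbrev Orbit : Type u := backwardOrbit f (iterField f)

/-- The iterated monodromy action: automorphisms of `K_∞` over `F(t)` move the points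
of the backward orbit of `t`. -/
instance : MulAction (IMG f) (Orbit f) where
  smul σ x := ⟨σ x.1, (map_mem_backwardOrbit_iff f (σ : iterField f →ₐ[RatFunc F] iterField f)
    x.1).2 x.2⟩
  one_smul _ := rfl
  mul_smul _ _ _ := rfl

end Dynamics

/-- Equivalence of group actions: a group isomorphism `φ` and a bijection `β` with
`β (g • ω) = φ g • β ω`. -/
def ActionsEquivalent (G Ω G' Ω' : Type*) [Group G] [MulAction G Ω] [Group G']
    [MulAction G' Ω'] : Prop :=
  ∃ (φ : G ≃* G') (β : Ω ≃ Ω'), ∀ (g : G) (ω : Ω), β (g • ω) = φ g • β ω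

/-- The base change of a rational map over `K` to the algebraic closure of `K`. -/
def toClosure {K : Type u} [Field K] (h : RatFunc K) : RatFunc (AlgebraicClosure K) :=
  h.eval (RatFunc.C.comp (algebraMap K (AlgebraicClosure K))) RatFunc.X

/-- A polynomial over an infinite field is additive if it induces an additive function. -/
def IsAdditive {k : Type v} [Field k] (f : k[X]) : Prop :=
  ∀ x y : k, f.eval (x + y) = f.eval x + f.eval y

/-- `h`, a rational map over the fraction field `K` of `R`, is a lift over `R` of the rational
map `f` over `k`, along `π : R → k`: it extends to a morphism of `ℙ¹` over `R`, i.e. `h = P / Q`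
with `P`, `Q` over `R` whose reductions are coprime and have the same maximal degree as `P`
and `Q`, and the special fibre is isomorphic to `f` as a dynamical system. -/
def IsLift {R : Type*} [CommRing R] {k : Type v} [Field k] (π : R →+* k) {K : Type u} [Field K]
    [Algebra R K] (f : RatFunc k) (h : RatFunc K) : Prop :=
  ∃ P Q : R[X],
    h = algebraMap K[X] (RatFunc K) (P.map (algebraMap R K)) /
      algebraMap K[X] (RatFunc K) (Q.map (algebraMap R K)) ∧
    IsCoprime (P.map π) (Q.map π) ∧
    max (P.map π).natDegree (Q.map π).natDegree = max P.natDegree Q.natDegree ∧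
    LinearlyConjugate (algebraMap k[X] (RatFunc k) (P.map π) /
      algebraMap k[X] (RatFunc k) (Q.map π)) f

end IterMonodromy

end

/-!
The iterated monodromy group alone, as an abstract group, tells an additive polynomial `f` in
characteristic `p` from every rational map `h` over a field of characteristic zero.

For `f` additive, two solutions of `f^n(x) = t` differ by a root of `f^n`, which is a constant. The
Galois group of `K_∞` over `k(t)` therefore acts on the backward orbit by translations by
constants, so it is commutative of exponent `p` (`IsAdditive.img_comm`, `IsAdditive.img_pow`). It is
not trivial, because the points of `f⁻¹(t)` are separable over `k(t)`, of degree at least `2`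
(`IsAdditive.exists_img_ne_one`).

Let `h` be a rational map over an algebraically closed field `F` of characteristic zero whose
iterated monodromy group is commutative of exponent `p`. For a point `x` of the backward orbit of
`t`, the field `F(x)` contains `t`, and by commutativity it is Galois over `F(t)`. Its Galois group
consists of Möbius transformations of `x`, commutes and has exponent `p`, and such a group has at
most `2 * p` elements (`encard_image_le`): once one of its elements is put into the form `y ↦ ζ y`,
all others have the form `y ↦ l y` or `y ↦ l / y`. If `h` had degree at least `2`, the degree of
`F(x)` over `F(t)` would be unbounded along the fibres (`exists_mem_fiber_le_finrank`). Hence `h` has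
degree at most `1` (`mapDegree_le_one`), but then its iterated monodromy group is trivial
(`img_eq_one`) and cannot be isomorphic to that of `f`.
-/

open Polynomial

noncomputable section

namespace IterMonodromy

open IntermediateField

universe u

/-! ### Evaluation at transcendental elements and Möbius transformations -/

section Field

variable {F L : Type u} [Field F] [Field L] [Algebra F L]

/-- The degree of a rational map: the larger of the degrees of its reduced numerator and
denominator. -/
def mapDegree (g : RatFunc F) : ℕ := max g.num.natDegree g.denom.natDegree

/-- Evaluation of rational functions at a transcendental element, which is a homomorphism of
fields. -/
def evalHom (x : L) (hx : Transcendental F x) : RatFunc F →ₐ[F] L :=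
  F⟮x⟯.val.comp (RatFunc.algEquivOfTranscendental x hx).toAlgHom

lemma evalHom_apply (x : L) (hx : Transcendental F x) (g : RatFunc F) :
    evalHom x hx g = g.eval (algebraMap F L) x := by
  simp only [evalHom, AlgHom.comp_apply, RatFunc.eval]
  exact RatFunc.algEquivOfTranscendental_apply x hx g

lemma evalHom_X (x : L) (hx : Transcendental F x) : evalHom x hx RatFunc.X = x := by
  simp [evalHom_apply]

lemma exists_evalHom_eq {x y : L} (hx : Transcendental F x) (hy : y ∈ F⟮x⟯) :
    ∃ g, evalHom x hx g = y := by
  obtain ⟨g, hg⟩ := (RatFunc.algEquivOfTranscendental x hx).surjective ⟨y, hy⟩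
  exact ⟨g, congrArg Subtype.val hg⟩

lemma eval_algEquiv (σ : L ≃ₐ[F] L) (g : RatFunc F) (x : L) :
    g.eval (algebraMap F L) (σ x) = σ (g.eval (algebraMap F L) x) := by
  simp only [RatFunc.eval, map_div₀, ← Polynomial.aeval_def, Polynomial.aeval_algHom_apply]

/-- A transcendental `x` is a rational expression in `g(x)` exactly when `g` has degree `1`. -/
lemma mem_adjoin_evalHom_iff {x : L} (hx : Transcendental F x) (g : RatFunc F) :
    x ∈ F⟮evalHom x hx g⟯ ↔ mapDegree g = 1 := by
  have h1 : F⟮evalHom x hx g⟯ = F⟮g⟯.map (evalHom x hx) := by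
    rw [IntermediateField.adjoin_map, Set.image_singleton]
  have h2 : x ∈ F⟮g⟯.map (evalHom x hx) ↔ RatFunc.X ∈ F⟮g⟯ := by
    rw [IntermediateField.mem_map]
    constructor
    · rintro ⟨u, hu, hux⟩
      rwa [← (evalHom x hx).injective (hux.trans (evalHom_X x hx).symm)]
    · exact fun h => ⟨_, h, evalHom_X x hx⟩
  rw [h1, h2, ← adjoin_simple_le_iff, RatFunc.adjoin_X, top_le_iff, mapDegree,
    ← RatFunc.finrank_eq_max_natDegree, finrank_eq_one_iff_eq_top]

lemma mapDegree_eq_zero_iff (g : RatFunc F) : mapDegree g = 0 ↔ ∃ c, g = RatFunc.C c := by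
  rw [RatFunc.eq_C_iff, mapDegree, Nat.max_eq_zero_iff]

lemma transcendental_evalHom {x : L} (hx : Transcendental F x) {g : RatFunc F}
    (hg : mapDegree g ≠ 0) : Transcendental F (evalHom x hx g) := by
  have h := g.transcendental_of_ne_C (by rwa [← mapDegree_eq_zero_iff])
  exact fun h' => h ((isAlgebraic_algHom_iff _ (evalHom x hx).injective).1 h')

lemma coeff_eq_zero_of_quadratic {x : L} (hx : Transcendental F x) {a b c : F}
    (h : algebraMap F L a * x ^ 2 + algebraMap F L b * x + algebraMap F L c = 0) :
    a = 0 ∧ b = 0 ∧ c = 0 := by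
  have h0 : C a * X ^ 2 + C b * X + C c = 0 := (transcendental_iff.1 hx) _ (by simpa using h)
  have h1 : ∀ n, (C a * X ^ 2 + C b * X + C c).coeff n = 0 := fun n => by rw [h0, coeff_zero]
  exact ⟨by simpa [coeff_X, coeff_C] using h1 2, by simpa [coeff_X, coeff_C] using h1 1,
    by simpa using h1 0⟩

lemma linear_ne_zero {x : L} (hx : Transcendental F x) {c d : F} (h : c ≠ 0 ∨ d ≠ 0) :
    algebraMap F L c * x + algebraMap F L d ≠ 0 := by
  intro h0
  have := coeff_eq_zero_of_quadratic hx (a := 0) (b := c) (c := d) (by simpa using h0)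
  tauto

/-- Two generators of the same purely transcendental extension of degree one differ by a Möbius
transformation. -/
lemma exists_mobius {x y : L} (hx : Transcendental F x) (h : F⟮y⟯ = F⟮x⟯) :
    ∃ a b c d : F, algebraMap F L c * x + algebraMap F L d ≠ 0 ∧
      y * (algebraMap F L c * x + algebraMap F L d) =
        algebraMap F L a * x + algebraMap F L b := by
  obtain ⟨g, rfl⟩ := exists_evalHom_eq hx (h ▸ mem_adjoin_simple_self F y)
  have hd : mapDegree g = 1 :=
    (mem_adjoin_evalHom_iff hx g).1 (h ▸ mem_adjoin_simple_self F x)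
  have e1 : ∀ q : F[X], q.natDegree ≤ 1 → q.eval₂ (algebraMap F L) x =
      algebraMap F L (q.coeff 1) * x + algebraMap F L (q.coeff 0) := by
    intro q hq
    conv_lhs => rw [eq_X_add_C_of_natDegree_le_one hq]
    simp
  have hn := e1 g.num (hd ▸ le_max_left _ _)
  have hD := e1 g.denom (hd ▸ le_max_right _ _)
  have hD0 : g.denom.eval₂ (algebraMap F L) x ≠ 0 := fun h0 =>
    g.denom_ne_zero ((transcendental_iff.1 hx) _ h0)
  refine ⟨g.num.coeff 1, g.num.coeff 0, g.denom.coeff 1, g.denom.coeff 0, hD ▸ hD0, ?_⟩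
  rw [← hn, ← hD, evalHom_apply, RatFunc.eval, div_mul_cancel₀ _ hD0]

lemma adjoin_linear {x : L} {a b : F} (ha : a ≠ 0) :
    F⟮algebraMap F L a * x + algebraMap F L b⟯ = F⟮x⟯ := by
  apply le_antisymm
  · rw [adjoin_simple_le_iff]
    exact add_mem (mul_mem (IntermediateField.algebraMap_mem _ _) (mem_adjoin_simple_self F x))
      (IntermediateField.algebraMap_mem _ _)
  · rw [adjoin_simple_le_iff]
    have ha' : algebraMap F L a ≠ 0 := by simpa using ha
    have h : algebraMap F L a⁻¹ *
        ((algebraMap F L a * x + algebraMap F L b) - algebraMap F L b) = x := by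
      simp [ha']
    exact Eq.subst (motive := (· ∈ F⟮algebraMap F L a * x + algebraMap F L b⟯)) h
      (mul_mem (IntermediateField.algebraMap_mem _ _)
        (sub_mem (mem_adjoin_simple_self F _) (IntermediateField.algebraMap_mem _ _)))

lemma adjoin_inv (x : L) : F⟮x⁻¹⟯ = F⟮x⟯ := by
  apply le_antisymm
  · exact adjoin_simple_le_iff.2 (inv_mem (mem_adjoin_simple_self F x))
  · exact adjoin_simple_le_iff.2 (by simpa using inv_mem (mem_adjoin_simple_self F x⁻¹))

lemma transcendental_of_adjoin_eq {x y : L} (hx : Transcendental F x) (h : F⟮y⟯ = F⟮x⟯) :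
    Transcendental F y := by
  intro hy
  have := isAlgebraic_adjoin_simple hy.isIntegral
  rw [h] at this
  exact hx (isAlgebraic_iff.1 (this.isAlgebraic (AdjoinSimple.gen F x)))

/-! ### Commuting Möbius transformations of finite order -/

/-- In the coordinate in which one Möbius transformation is multiplication by `ζ ≠ 1`, those
commuting with it are `y ↦ l y` or `y ↦ l / y`. -/
lemma commuting_eigen {y : L} (hy : Transcendental F y) (σ τ : L ≃ₐ[F] L) {ζ : F}
    (hζ : ζ ≠ 1) (hζ0 : ζ ≠ 0) (hσ : σ y = algebraMap F L ζ * y) (hc : σ (τ y) = τ (σ y))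
    (hτ : F⟮τ y⟯ = F⟮y⟯) :
    ∃ l : F, τ y = algebraMap F L l * y ∨ τ y * y = algebraMap F L l := by
  obtain ⟨a, b, c, d, h0, he⟩ := exists_mobius hy hτ
  have he2 : algebraMap F L ζ * τ y *
      (algebraMap F L c * (algebraMap F L ζ * y) + algebraMap F L d) =
      algebraMap F L a * (algebraMap F L ζ * y) + algebraMap F L b := by
    have h1 : σ (τ y) = algebraMap F L ζ * τ y := by rw [hc, hσ, map_mul, AlgEquiv.commutes]
    have := congrArg σ he
    simpa only [map_mul, map_add, AlgEquiv.commutes, h1, hσ] using this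
  have he3 : (algebraMap F L a * (algebraMap F L ζ * y) + algebraMap F L b) *
      (algebraMap F L c * y + algebraMap F L d) = algebraMap F L ζ *
      (algebraMap F L a * y + algebraMap F L b) *
      (algebraMap F L c * (algebraMap F L ζ * y) + algebraMap F L d) := by
    rw [← he, ← he2]; ring
  obtain ⟨h2, -, h1⟩ := coeff_eq_zero_of_quadratic hy (a := a * c * ζ * (1 - ζ))
    (b := b * c * (1 - ζ ^ 2)) (c := b * d * (1 - ζ)) (by
      simp only [map_mul, map_sub, map_one, map_pow]
      linear_combination he3)
  have hζ1 : 1 - ζ ≠ 0 := sub_ne_zero.2 hζ.symm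
  have c2 : a = 0 ∨ c = 0 := by simpa [hζ0, hζ1] using h2
  have c0 : b = 0 ∨ d = 0 := by simpa [hζ1] using h1
  -- `τ y = (a y + b) / (c y + d)` with `a c = 0 = b d`.
  have hτ0 : τ y ≠ 0 := by
    intro h1
    rw [(map_eq_zero _).1 h1] at hy
    exact hy isAlgebraic_zero
  by_cases hcz : c = 0
  · subst hcz
    have hd : algebraMap F L d ≠ 0 := by simpa using h0
    have hb : b = 0 := c0.resolve_right fun h => hd (by simp [h])
    subst hb
    refine ⟨a / d, Or.inl ?_⟩
    rw [map_div₀]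
    field_simp
    simpa using he
  · have ha : a = 0 := c2.resolve_right hcz
    subst ha
    have hb : b ≠ 0 := by
      rintro rfl
      exact mul_ne_zero hτ0 h0 (by simpa using he)
    have hd : d = 0 := c0.resolve_left hb
    subst hd
    have hcL : algebraMap F L c ≠ 0 := (_root_.map_ne_zero _).2 hcz
    refine ⟨b / c, Or.inr ?_⟩
    rw [map_div₀]
    field_simp
    simp only [map_zero] at he
    linear_combination he

variable [IsAlgClosed F]

/-- A Möbius transformation over an algebraically closed field has a fixed point; moving it to
infinity makes the transformation affine. -/
lemma exists_affine {x : L} (hx : Transcendental F x) (σ : L ≃ₐ[F] L)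
    (h : F⟮σ x⟯ = F⟮x⟯) :
    ∃ y, F⟮y⟯ = F⟮x⟯ ∧ ∃ α β : F, σ y = algebraMap F L α * y + algebraMap F L β := by
  obtain ⟨a, b, c, d, h0, he⟩ := exists_mobius hx h
  by_cases hc : c = 0
  · subst hc
    have hd : algebraMap F L d ≠ 0 := by simpa using h0
    refine ⟨x, rfl, a / d, b / d, ?_⟩
    simp only [map_zero, zero_mul, zero_add] at he
    simp only [map_div₀]
    field_simp
    exact he
  · -- A root `r` of this quadratic is a fixed point of `z ↦ (a z + b) / (c z + d)`.
    obtain ⟨r, hr⟩ := IsAlgClosed.exists_root (C c * X ^ 2 + C (d - a) * X + C (-b))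
      (by rw [degree_quadratic hc]; decide)
    have hr' : c * r ^ 2 + (d - a) * r - b = 0 := by
      simp [IsRoot] at hr
      linear_combination hr
    have hrL : algebraMap F L c * algebraMap F L r ^ 2 +
        (algebraMap F L d - algebraMap F L a) * algebraMap F L r - algebraMap F L b = 0 := by
      simpa using congrArg (algebraMap F L) hr'
    have key : (σ x - algebraMap F L r) * (algebraMap F L c * x + algebraMap F L d) =
        algebraMap F L (a - c * r) * (x - algebraMap F L r) := by
      simp only [map_sub, map_mul]
      linear_combination he - hrL
    have hxr : x - algebraMap F L r ≠ 0 := by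
      have := linear_ne_zero hx (c := 1) (d := -r) (Or.inl one_ne_zero)
      simpa [sub_eq_add_neg] using this
    have hσr : σ x - algebraMap F L r ≠ 0 := by
      intro h1
      apply hxr
      apply σ.injective
      simpa using h1
    have hA : algebraMap F L (a - c * r) ≠ 0 := by
      intro h1
      rw [h1, zero_mul] at key
      exact (mul_ne_zero hσr h0) key
    refine ⟨(x - algebraMap F L r)⁻¹, ?_, (d + c * r) / (a - c * r), c / (a - c * r), ?_⟩
    · rw [adjoin_inv]
      have := adjoin_linear (x := x) (a := (1 : F)) (b := -r) one_ne_zero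
      simpa [sub_eq_add_neg] using this
    · rw [map_inv₀, map_sub, AlgEquiv.commutes, map_div₀, map_div₀]
      field_simp
      simp only [map_add, map_mul]
      linear_combination -key

/-- A nontrivial Möbius transformation whose `p`-th power is trivial, with `p` invertible in the
ground field, is diagonalizable: in a suitable coordinate it is multiplication by a constant. -/
lemma exists_eigen {p : ℕ} (hp : (p : F) ≠ 0) {x : L} (hx : Transcendental F x)
    (σ : L ≃ₐ[F] L) (h : F⟮σ x⟯ = F⟮x⟯) (hσp : σ ^ p = 1) (hσ : σ x ≠ x) :
    ∃ y, F⟮y⟯ = F⟮x⟯ ∧ ∃ ζ : F, ζ ≠ 1 ∧ ζ ≠ 0 ∧ σ y = algebraMap F L ζ * y := by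
  obtain ⟨y, hy, α, β, hyσ⟩ := exists_affine hx σ h
  have hyne : σ y ≠ y := by
    intro h1
    obtain ⟨g, hg⟩ := exists_evalHom_eq (transcendental_of_adjoin_eq hx hy)
      (hy ▸ mem_adjoin_simple_self F x)
    apply hσ
    rw [← hg, evalHom_apply, ← eval_algEquiv, h1]
  -- If `α = 1`, then `σ ^ p` is the translation by `p * β`, which is trivial only for `β = 0`.
  have hα1 : α ≠ 1 := by
    rintro rfl
    have hn : ∀ n : ℕ, (σ ^ n) y = y + n * algebraMap F L β := by
      intro n
      induction n with
      | zero => simp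
      | succ n ih =>
        rw [pow_succ, AlgEquiv.mul_apply, hyσ, map_add, map_mul, AlgEquiv.commutes,
          AlgEquiv.commutes, ih]
        simp only [map_one, Nat.cast_add, Nat.cast_one]
        ring
    have h2 := hn p
    rw [hσp, AlgEquiv.one_apply] at h2
    have h3 : algebraMap F L (p * β) = 0 := by
      simpa using h2
    have hβ : β = 0 := by simpa [hp] using (map_eq_zero _).1 h3
    apply hyne
    rw [hyσ, hβ]
    simp
  have h1α : algebraMap F L (1 - α) ≠ 0 :=
    (_root_.map_ne_zero _).2 (sub_ne_zero.2 hα1.symm)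
  have hα0 : α ≠ 0 := by
    rintro rfl
    have : σ y = σ (algebraMap F L β) := by simpa using hyσ
    have h4 := transcendental_of_adjoin_eq hx hy
    rw [σ.injective this] at h4
    exact h4 (isAlgebraic_algebraMap β)
  -- The second fixed point is `β / (1 - α)`; it is moved to the origin.
  refine ⟨algebraMap F L 1 * y + algebraMap F L (-(β / (1 - α))), ?_, α, hα1, hα0, ?_⟩
  · rw [adjoin_linear one_ne_zero, hy]
  · simp only [map_add, map_mul, AlgEquiv.commutes, hyσ]
    simp only [map_one, map_neg, map_div₀, one_mul]
    field_simp
    simp only [map_sub, map_one]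
    ring

/-- A commutative group of Möbius transformations of exponent `p`, with `p` invertible in the
ground field, has at most `2 * p` elements: diagonalize one of them, with eigenvalue ratio `ζ`;
the others multiply the coordinate `y` by a `p`-th root of unity, or invert it up to a constant,
and any two of the latter kind differ by one of the former. The group is given by its action on
`F(x)`, inside a possibly larger field, and its elements are counted by the images of `x`. -/
lemma encard_image_le {p : ℕ} (hp : (p : F) ≠ 0) {x : L} (hx : Transcendental F x)
    (S : Subgroup (L ≃ₐ[F] L)) (hcomm : ∀ σ ∈ S, ∀ τ ∈ S, σ * τ = τ * σ)
    (hexp : ∀ σ ∈ S, σ ^ p = 1) (hmem : ∀ σ ∈ S, σ x ∈ F⟮x⟯) :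
    ((fun σ : L ≃ₐ[F] L => σ x) '' S).encard ≤ 2 * p := by
  have hp0 : 0 < p := Nat.pos_of_ne_zero fun h => hp (by simp [h])
  have hmap : ∀ τ : L ≃ₐ[F] L, ∀ z : L, F⟮τ z⟯ = F⟮z⟯.map (τ : L →ₐ[F] L) := by
    intro τ z
    rw [IntermediateField.adjoin_map, Set.image_singleton]
    rfl
  have hgen : ∀ σ ∈ S, F⟮σ x⟯ = F⟮x⟯ := by
    intro σ hσ
    apply le_antisymm (adjoin_simple_le_iff.2 (hmem σ hσ))
    rw [adjoin_simple_le_iff, hmap]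
    exact ⟨σ⁻¹ x, hmem _ (inv_mem hσ), σ.apply_symm_apply x⟩
  by_cases htriv : ∀ σ ∈ S, σ x = x
  · have h1 : ((fun σ : L ≃ₐ[F] L => σ x) '' S) ⊆ {x} := by
      rintro _ ⟨σ, hσ, rfl⟩
      exact htriv σ hσ
    refine (Set.encard_le_encard h1).trans ?_
    rw [Set.encard_singleton]
    exact_mod_cast (by omega : 1 ≤ 2 * p)
  push Not at htriv
  obtain ⟨σ, hσ, hσx⟩ := htriv
  obtain ⟨y, hy, ζ, hζ1, hζ0, hσy⟩ := exists_eigen hp hx σ (hgen σ hσ) (hexp σ hσ) hσx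
  have hyt := transcendental_of_adjoin_eq hx hy
  have hy0 : y ≠ 0 := by
    rintro rfl
    exact hyt isAlgebraic_zero
  have hgeny : ∀ τ ∈ S, F⟮τ y⟯ = F⟮y⟯ := by
    intro τ hτ
    rw [hmap, hy, ← hmap, hgen τ hτ]
  have hform : ∀ τ ∈ S, ∃ l : F, τ y = algebraMap F L l * y ∨ τ y * y = algebraMap F L l :=
    fun τ hτ => commuting_eigen hyt σ τ hζ1 hζ0 hσy
      (congrArg (fun ρ : L ≃ₐ[F] L => ρ y) (hcomm σ hσ τ hτ)) (hgeny τ hτ)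
  have hroot : ∀ τ ∈ S, ∀ l : F, τ y = algebraMap F L l * y → l ∈ nthRootsFinset p (1 : F) := by
    intro τ hτ l hl
    have hn : ∀ n : ℕ, (τ ^ n) y = algebraMap F L (l ^ n) * y := by
      intro n
      induction n with
      | zero => simp
      | succ n ih =>
        rw [pow_succ, AlgEquiv.mul_apply, hl, map_mul, AlgEquiv.commutes, ih, pow_succ, map_mul]
        ring
    have h1 := hn p
    rw [hexp τ hτ, AlgEquiv.one_apply] at h1
    rw [mem_nthRootsFinset hp0]
    apply (algebraMap F L).injective
    rw [map_one]
    exact mul_right_cancel₀ hy0 (by rw [one_mul, ← h1])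
  -- The orbit of `y` is contained in the union of `μ_p • y` and, if some `τ₀` inverts `y` up to a
  -- constant, of `μ_p • τ₀ y`.
  obtain ⟨w, hw⟩ : ∃ w : L, ∀ τ ∈ S, ∃ l ∈ nthRootsFinset p (1 : F),
      τ y = algebraMap F L l * y ∨ τ y = algebraMap F L l * w := by
    by_cases hinv : ∃ τ₀ ∈ S, ∃ l₀ : F, τ₀ y * y = algebraMap F L l₀
    · obtain ⟨τ₀, hτ₀, l₀, hl₀⟩ := hinv
      refine ⟨τ₀ y, fun τ hτ => ?_⟩
      obtain ⟨l, hl | hl⟩ := hform τ hτ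
      · exact ⟨l, hroot τ hτ l hl, Or.inl hl⟩
      · have hτy : τ y ≠ 0 := (_root_.map_ne_zero _).2 hy0
        have hτ₀y : τ₀ y ≠ 0 := (_root_.map_ne_zero _).2 hy0
        have hlL : algebraMap F L l ≠ 0 := hl ▸ mul_ne_zero hτy hy0
        have hl₀L : algebraMap F L l₀ ≠ 0 := hl₀ ▸ mul_ne_zero hτ₀y hy0
        refine ⟨l / l₀, ?_, Or.inr ?_⟩
        · apply hroot (τ₀ * τ) (mul_mem hτ₀ hτ)
          rw [AlgEquiv.mul_apply]
          have h2 := congrArg τ₀ hl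
          rw [map_mul, AlgEquiv.commutes] at h2
          rw [map_div₀, eq_comm, div_mul_eq_mul_div, div_eq_iff hl₀L, ← hl₀, ← h2]
          ring
        · rw [map_div₀, ← hl, ← hl₀]
          field_simp
    · refine ⟨0, fun τ hτ => ?_⟩
      obtain ⟨l, hl | hl⟩ := hform τ hτ
      · exact ⟨l, hroot τ hτ l hl, Or.inl hl⟩
      · exact (hinv ⟨τ, hτ, l, hl⟩).elim
  obtain ⟨g, hg⟩ := exists_evalHom_eq hyt (hy ▸ mem_adjoin_simple_self F x)
  classical
  have hsub : ((fun σ : L ≃ₐ[F] L => σ x) '' S) ⊆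
      (fun z => g.eval (algebraMap F L) z) '' (((nthRootsFinset p (1 : F)).image
        (fun l => algebraMap F L l * y) ∪ (nthRootsFinset p (1 : F)).image
        (fun l => algebraMap F L l * w) : Finset L) : Set L) := by
    rintro _ ⟨τ, hτ, rfl⟩
    refine ⟨τ y, ?_, ?_⟩
    · obtain ⟨l, hl, h | h⟩ := hw τ hτ
      · exact Finset.mem_coe.2 (Finset.mem_union_left _ (Finset.mem_image.2 ⟨l, hl, h.symm⟩))
      · exact Finset.mem_coe.2 (Finset.mem_union_right _ (Finset.mem_image.2 ⟨l, hl, h.symm⟩))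
    · simp only [← hg, evalHom_apply]
      exact eval_algEquiv τ g y
  refine (Set.encard_le_encard hsub).trans ((Set.encard_image_le _ _).trans ?_)
  rw [Set.encard_coe_eq_coe_finsetCard]
  have hc : (nthRootsFinset p (1 : F)).card ≤ p := by
    rw [nthRootsFinset_def]
    exact (Multiset.toFinset_card_le _).trans (card_nthRoots p 1)
  have := (Finset.card_union_le _ _).trans (add_le_add
    (Finset.card_image_le (s := nthRootsFinset p (1 : F)) (f := fun l => algebraMap F L l * y))
    (Finset.card_image_le (s := nthRootsFinset p (1 : F)) (f := fun l => algebraMap F L l * w)))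
  exact_mod_cast (by omega : _ ≤ 2 * p)

end Field

/-! ### Iterates of rational maps and fibres -/

section Iteration

variable {F L : Type u} [Field F] [Field L] [Algebra F L]

lemma aeval_mem_adjoin (q : F[X]) (x : L) : aeval x q ∈ F⟮x⟯ :=
  algebra_adjoin_le_adjoin F {x} (aeval_mem_adjoin_singleton F x)

lemma eval_mem_adjoin (g : RatFunc F) (x : L) : g.eval (algebraMap F L) x ∈ F⟮x⟯ := by
  have h : ∀ q : F[X], q.eval₂ (algebraMap F L) x ∈ F⟮x⟯ := fun q =>
    aeval_mem_adjoin q x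
  exact div_mem (h _) (h _)

lemma transcendental_of_eval {g : RatFunc F} {x : L}
    (h : Transcendental F (g.eval (algebraMap F L) x)) : Transcendental F x := by
  intro hx
  have := isAlgebraic_adjoin_simple hx.isIntegral
  exact h (isAlgebraic_iff.1 (this.isAlgebraic ⟨_, eval_mem_adjoin g x⟩))

/-- No denominator vanishes at a transcendental point, so evaluating an iterate there is iterating
the evaluation. -/
lemma eval_iter (h : RatFunc F) (n : ℕ) {x : L} (hx : Transcendental F x) :
    (iter h n).eval (algebraMap F L) x = (fun y => h.eval (algebraMap F L) y)^[n] x := by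
  induction n with
  | zero => simp [iter]
  | succ n ih =>
    rw [Function.iterate_succ_apply', ← ih, ← evalHom_apply x hx, ← evalHom_apply x hx]
    have h3 : ((evalHom x hx : RatFunc F →ₐ[F] L) : RatFunc F →+* L).comp RatFunc.C =
        algebraMap F L := by
      ext a
      simp [← RatFunc.algebraMap_eq_C]
    simp only [iter, comp, RatFunc.eval, map_div₀]
    rw [← h3, ← AlgHom.coe_toRingHom, Polynomial.hom_eval₂, Polynomial.hom_eval₂]

/-- A nonconstant rational map over `F` takes every value that is transcendental over `F`. -/
lemma exists_eval_eq [IsAlgClosed L] {h : RatFunc F} (hh : mapDegree h ≠ 0) {x : L}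
    (hx : Transcendental F x) : ∃ z, h.eval (algebraMap F L) z = x := by
  -- The coefficient of `Q` at the degree of `h` does not cancel, since `x` is not in `F`.
  set Q : L[X] := h.num.map (algebraMap F L) - C x * h.denom.map (algebraMap F L) with hQ
  have hc : h.num.coeff (mapDegree h) ≠ 0 ∨ h.denom.coeff (mapDegree h) ≠ 0 := by
    rcases max_choice h.num.natDegree h.denom.natDegree with h1 | h1
    · left
      rw [mapDegree, h1, coeff_natDegree, Ne, leadingCoeff_eq_zero]
      intro h2
      apply hh
      rw [mapDegree, h1, h2, natDegree_zero]
    · right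
      rw [mapDegree, h1, coeff_natDegree, Ne, leadingCoeff_eq_zero]
      exact h.denom_ne_zero
  have hQc : Q.coeff (mapDegree h) ≠ 0 := by
    have := linear_ne_zero hx (c := -h.denom.coeff (mapDegree h))
      (d := h.num.coeff (mapDegree h)) (by simpa using hc.symm)
    intro h0
    apply this
    rw [← h0, hQ]
    simp
    ring
  have hdeg : Q.degree ≠ 0 := by
    intro h0
    exact hQc (coeff_eq_zero_of_natDegree_lt
      (by rw [natDegree_eq_of_degree_eq_some h0]; exact Nat.pos_of_ne_zero hh))
  obtain ⟨z, hz⟩ := IsAlgClosed.exists_root Q hdeg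
  have hz' : h.num.eval₂ (algebraMap F L) z - x * h.denom.eval₂ (algebraMap F L) z = 0 := by
    simpa [hQ, eval₂_eq_eval_map] using hz
  refine ⟨z, ?_⟩
  have hd : h.denom.eval₂ (algebraMap F L) z ≠ 0 := by
    intro h0
    rw [h0, mul_zero, sub_zero] at hz'
    obtain ⟨u, v, huv⟩ := h.isCoprime_num_denom
    have := congrArg (eval₂ (algebraMap F L) z) huv
    simp [h0, hz'] at this
  rw [RatFunc.eval, div_eq_iff hd]
  linear_combination hz'

variable [Algebra (RatFunc F) L] [IsScalarTower F (RatFunc F) L]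

/-- The image in `L` of the parameter `t` of `F(t)`. -/
abbrev param (F L : Type u) [Field F] [Field L] [Algebra (RatFunc F) L] : L :=
  algebraMap (RatFunc F) L RatFunc.X

lemma transcendental_param : Transcendental F (param F L) := by
  have h1 : Transcendental F (RatFunc.X : RatFunc F) := by
    apply RatFunc.transcendental_of_ne_C
    rw [RatFunc.eq_C_iff]
    simp
  exact fun h => h1 ((isAlgebraic_algebraMap_iff (algebraMap (RatFunc F) L).injective).1 h)

lemma algebraMap_comp_C : (algebraMap (RatFunc F) L).comp RatFunc.C = algebraMap F L := by
  rw [IsScalarTower.algebraMap_eq F (RatFunc F) L, RatFunc.algebraMap_eq_C]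

/-- Values at algebraic points are algebraic, whereas `t` is transcendental. -/
lemma transcendental_of_mem_fiber {h : RatFunc F} {n : ℕ} {x : L} (hx : x ∈ fiber h L n) :
    Transcendental F x := by
  apply transcendental_of_eval (g := iter h n)
  simp only [fiber, Set.mem_ofPred_eq, algebraMap_comp_C] at hx
  rw [hx]
  exact transcendental_param

lemma mem_fiber_iff {h : RatFunc F} {n : ℕ} {x : L} (hx : Transcendental F x) :
    x ∈ fiber h L n ↔ (fun y => h.eval (algebraMap F L) y)^[n] x = param F L := by
  simp only [fiber, Set.mem_ofPred_eq, algebraMap_comp_C, eval_iter h n hx]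

lemma param_mem_of_mem_fiber {h : RatFunc F} {n : ℕ} {x : L} (hx : x ∈ fiber h L n) :
    param F L ∈ F⟮x⟯ := by
  simp only [fiber, Set.mem_ofPred_eq, algebraMap_comp_C] at hx
  exact (congrArg (· ∈ F⟮x⟯) hx).mp (eval_mem_adjoin _ x)

lemma algebraMap_mem_adjoin_param (g : RatFunc F) :
    algebraMap (RatFunc F) L g ∈ F⟮param F L⟯ := by
  have h1 : ∀ q : F[X], algebraMap (RatFunc F) L (algebraMap F[X] (RatFunc F) q) =
      aeval (param F L) q := by
    intro q
    rw [← RatFunc.aeval_X_left_eq_algebraMap, aeval_algebraMap_apply]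
  rw [← RatFunc.num_div_denom g, map_div₀, h1, h1]
  exact div_mem (aeval_mem_adjoin _ _) (aeval_mem_adjoin _ _)

/-- If `t ∈ F(x)`, then `F(t)(x) = F(x)`. -/
lemma mem_adjoin_of_mem_adjoin {x y : L} (ht : param F L ∈ F⟮x⟯) (hy : y ∈ (RatFunc F)⟮x⟯) :
    y ∈ F⟮x⟯ := by
  induction hy using adjoin_induction with
  | mem z hz => rw [Set.mem_singleton_iff.1 hz]; exact mem_adjoin_simple_self F x
  | algebraMap g => exact (adjoin_simple_le_iff.2 ht) (algebraMap_mem_adjoin_param g)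
  | add _ _ _ _ h1 h2 => exact add_mem h1 h2
  | inv _ _ h1 => exact inv_mem h1
  | mul _ _ _ _ h1 h2 => exact mul_mem h1 h2

lemma mem_adjoin_ratFunc {x y : L} (hy : y ∈ F⟮x⟯) : y ∈ (RatFunc F)⟮x⟯ := by
  have : F⟮x⟯ ≤ (RatFunc F)⟮x⟯.restrictScalars F :=
    adjoin_simple_le_iff.2 (mem_adjoin_simple_self (RatFunc F) x)
  exact this hy

end Iteration

/-! ### Iterated monodromy of rational maps of small degree, and in characteristic zero -/

section Monodromy

variable {F : Type u} [Field F] (h : RatFunc F)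

/-- `K_∞` is normal over `F(t)`, being generated by a Galois-stable set. -/
instance normal_iterField : Normal (RatFunc F) (iterField h) := by
  rw [normal_iff_forall_map_le]
  intro σ
  rw [iterField, IntermediateField.adjoin_map, adjoin_le_iff]
  rintro _ ⟨x, hx, rfl⟩
  exact subset_adjoin _ _ ((map_mem_backwardOrbit_iff h σ x).2 hx)

variable {h}

/-- An automorphism of `K_∞` is determined by its action on the backward orbit. -/
lemma img_ext {σ τ : IMG h}
    (hx : ∀ x ∈ backwardOrbit h (iterField h), σ x = τ x) : σ = τ := by
  have h1 : (σ : iterField h →ₐ[RatFunc F] iterField h) = τ := by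
    refine algHom_ext_of_eq_adjoin _ (s := backwardOrbit h (AlgebraicClosure (RatFunc F))) rfl
      fun x hx' => ?_
    exact hx _ ((map_mem_backwardOrbit_iff h (iterField h).val _).1 hx')
  ext y
  exact congrArg Subtype.val (DFunLike.congr_fun h1 y)

/-- A map of degree `1` is invertible, and so are its iterates. -/
lemma mem_adjoin_iterate (hh : mapDegree h = 1) {L : Type u} [Field L] [Algebra F L] (n : ℕ) :
    ∀ x : L, Transcendental F x → x ∈ F⟮(fun y => h.eval (algebraMap F L) y)^[n] x⟯ := by
  induction n with
  | zero => exact fun x _ => mem_adjoin_simple_self F x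
  | succ n ih =>
    intro x hx
    rw [Function.iterate_succ_apply]
    have h1 := transcendental_evalHom hx (g := h) (by omega)
    have h2 := (mem_adjoin_evalHom_iff hx h).2 hh
    rw [evalHom_apply] at h1 h2
    exact (adjoin_simple_le_iff.2 (ih _ h1)) h2

/-- Rational maps of degree at most `1` have trivial iterated monodromy. -/
lemma img_eq_one (hh : mapDegree h ≤ 1) (σ : IMG h) : σ = 1 := by
  have hbot : iterField h = ⊥ := by
    rw [iterField, eq_bot_iff, adjoin_le_iff]
    rintro x ⟨n, hn, hx⟩
    have hxt := transcendental_of_mem_fiber hx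
    have hx' := (mem_fiber_iff hxt).1 hx
    rcases Nat.le_one_iff_eq_zero_or_eq_one.1 hh with h0 | h1
    · obtain ⟨c, rfl⟩ := (mapDegree_eq_zero_iff h).1 h0
      obtain ⟨m, rfl⟩ : ∃ m, n = m + 1 := ⟨n - 1, by omega⟩
      simp only [Function.iterate_succ_apply', RatFunc.eval_C] at hx'
      exact (transcendental_param (F := F) (hx' ▸ isAlgebraic_algebraMap c)).elim
    · have := mem_adjoin_iterate h1 n x hxt
      rw [hx'] at this
      have hle : F⟮param F (AlgebraicClosure (RatFunc F))⟯ ≤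
          (⊥ : IntermediateField (RatFunc F)
            (AlgebraicClosure (RatFunc F))).restrictScalars F :=
        adjoin_simple_le_iff.2 ((mem_restrictScalars F).2 (IntermediateField.algebraMap_mem _ _))
      exact hle this
  ext y
  obtain ⟨g, hg⟩ := mem_bot.1 (hbot.le y.2)
  have hy : y = algebraMap (RatFunc F) (iterField h) g := Subtype.ext hg.symm
  rw [hy, AlgEquiv.commutes, AlgEquiv.commutes]

/-- The points of the fibres of a map of degree at least `2` have unbounded degree over `F(t)`. -/
lemma exists_mem_fiber_le_finrank (hh : 2 ≤ mapDegree h) (n : ℕ) :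
    ∃ x ∈ fiber h (AlgebraicClosure (RatFunc F)) n,
      n + 1 ≤ Module.finrank (RatFunc F) (RatFunc F)⟮x⟯ := by
  induction n with
  | zero =>
    refine ⟨param F _, (mem_fiber_iff transcendental_param).2 rfl, ?_⟩
    have := adjoin.finiteDimensional (Algebra.IsIntegral.isIntegral (R := RatFunc F)
      (param F (AlgebraicClosure (RatFunc F))))
    exact Nat.succ_le_of_lt Module.finrank_pos
  | succ n ih =>
    obtain ⟨x, hx, hn⟩ := ih
    have hxt := transcendental_of_mem_fiber hx
    obtain ⟨z, rfl⟩ := exists_eval_eq (h := h) (by omega) hxt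
    have hzt := transcendental_of_eval hxt
    refine ⟨z, (mem_fiber_iff hzt).2 ?_, ?_⟩
    · rw [Function.iterate_succ_apply]
      exact (mem_fiber_iff hxt).1 hx
    set x := h.eval (algebraMap F (AlgebraicClosure (RatFunc F))) z with hxz
    have hlt : (RatFunc F)⟮x⟯ < (RatFunc F)⟮z⟯ := by
      refine lt_of_le_of_ne
        (adjoin_simple_le_iff.2 (mem_adjoin_ratFunc (eval_mem_adjoin h z))) fun heq => ?_
      have h1 : z ∈ F⟮x⟯ := mem_adjoin_of_mem_adjoin (param_mem_of_mem_fiber hx)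
        (heq ▸ mem_adjoin_simple_self _ z)
      rw [hxz, ← evalHom_apply z hzt, mem_adjoin_evalHom_iff] at h1
      omega
    have := adjoin.finiteDimensional (Algebra.IsIntegral.isIntegral (R := RatFunc F) z)
    have : FiniteDimensional (RatFunc F)
        (Subalgebra.toSubmodule (RatFunc F)⟮z⟯.toSubalgebra) := this
    have := Submodule.finrank_lt_finrank_of_lt
      (s := Subalgebra.toSubmodule (RatFunc F)⟮x⟯.toSubalgebra)
      (t := Subalgebra.toSubmodule (RatFunc F)⟮z⟯.toSubalgebra) hlt
    exact Nat.succ_le_of_lt (lt_of_le_of_lt hn this)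

/-- If the iterated monodromy group is commutative, then each element of `K_∞` generates a Galois
extension of `F(t)`. -/
lemma apply_mem_adjoin [CharZero F] (hcomm : ∀ σ τ : IMG h, σ * τ = τ * σ)
    (σ : IMG h) (x : iterField h) : σ x ∈ (RatFunc F)⟮x⟯ := by
  have : IsGalois (RatFunc F) (iterField h) := ⟨⟩
  rw [← InfiniteGalois.fixedField_fixingSubgroup (RatFunc F)⟮x⟯, mem_fixedField_iff]
  intro τ hτ
  have h1 : τ x = x := by
    rw [IntermediateField.mem_fixingSubgroup_iff] at hτ
    exact hτ x (mem_adjoin_simple_self _ x)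
  have h2 := congrArg (fun ρ : IMG h => ρ x) (hcomm τ σ)
  simp only [AlgEquiv.mul_apply, h1] at h2
  exact h2

/-- In characteristic zero, only maps of degree at most `1` have a commutative iterated monodromy
group of finite exponent `p`: the Galois orbit of a point `x` of a high fibre is as large as its
degree over `F(t)`, while it is the orbit of `x` under a group of Möbius transformations of `x` to
which `encard_image_le` applies. -/
theorem mapDegree_le_one [CharZero F] [IsAlgClosed F] {p : ℕ} (hp : p ≠ 0)
    (hcomm : ∀ σ τ : IMG h, σ * τ = τ * σ) (hexp : ∀ σ : IMG h, σ ^ p = 1) :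
    mapDegree h ≤ 1 := by
  by_contra! hh
  obtain ⟨x, hx, hdeg⟩ := exists_mem_fiber_le_finrank (n := 2 * p) hh
  have hxmem : x ∈ iterField h := subset_adjoin _ _ ⟨2 * p, by omega, hx⟩
  set y : iterField h := ⟨x, hxmem⟩ with hy
  have hyf : y ∈ fiber h (iterField h) (2 * p) :=
    (map_mem_fiber_iff h (iterField h).val (2 * p) y).1 hx
  have hmin : minpoly (RatFunc F) y = minpoly (RatFunc F) x :=
    (minpoly.algHom_eq (iterField h).val (iterField h).val.injective y).symm
  have hint : IsIntegral (RatFunc F) y := Algebra.IsIntegral.isIntegral y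
  rw [adjoin.finrank (Algebra.IsIntegral.isIntegral x), ← hmin] at hdeg
  have hbound := encard_image_le (F := F) (L := iterField h) (p := p) (by exact_mod_cast hp)
    (transcendental_of_mem_fiber hyf)
    ((⊤ : Subgroup (IMG h)).map (AlgEquiv.restrictScalarsHom F))
    (by
      rintro _ ⟨σ, -, rfl⟩ _ ⟨τ, -, rfl⟩
      rw [← map_mul, ← map_mul, hcomm])
    (by
      rintro _ ⟨σ, -, rfl⟩
      rw [← map_pow, hexp, map_one])
    (by
      rintro _ ⟨σ, -, rfl⟩
      exact mem_adjoin_of_mem_adjoin (param_mem_of_mem_fiber hyf) (apply_mem_adjoin hcomm σ y))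
  have hroots : (minpoly (RatFunc F) y).rootSet (iterField h) ⊆
      ((fun σ : iterField h ≃ₐ[F] iterField h => σ y) ''
        ((⊤ : Subgroup (IMG h)).map (AlgEquiv.restrictScalarsHom F))) := by
    intro z hz
    obtain ⟨σ, hσ⟩ := isConjRoot_iff_exists_algEquiv.1
      (isConjRoot_iff_mem_minpoly_rootSet hint |>.2 hz).symm
    exact ⟨AlgEquiv.restrictScalarsHom F σ, ⟨σ, trivial, rfl⟩, hσ⟩
  have hcard : ((minpoly (RatFunc F) y).rootSet (iterField h)).encard =
      (minpoly (RatFunc F) y).natDegree := by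
    rw [← Polynomial.card_rootSet_eq_natDegree (K := iterField h)
      (minpoly.irreducible hint).separable (Normal.splits inferInstance y),
      ← Nat.card_eq_fintype_card, Nat.card_coe_set_eq, Set.Finite.cast_ncard_eq]
    exact rootSet_finite _ _
  have := (Set.encard_le_encard hroots).trans hbound
  rw [hcard] at this
  have : (minpoly (RatFunc F) y).natDegree ≤ 2 * p := by exact_mod_cast this
  omega

end Monodromy

/-! ### Iterated monodromy of additive polynomials -/

section Additive

variable {k : Type u} [Field k] {f : k[X]}

lemma IsAdditive.comp_eq [Infinite k] (hf : IsAdditive f) (y : k) :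
    f.comp (X + C y) = f + C (f.eval y) :=
  Polynomial.funext fun x => by simpa using hf x y

/-- An additive polynomial is additive on every extension of an infinite ground field. -/
lemma IsAdditive.aeval_add [Infinite k] (hf : IsAdditive f) {L : Type*} [Field L] [Algebra k L]
    (x y : L) : aeval (x + y) f = aeval x f + aeval y f := by
  have h1 : ∀ c : k, aeval (x + algebraMap k L c) f = aeval x f + aeval (algebraMap k L c) f := by
    intro c
    simpa [aeval_comp, aeval_algebraMap_apply] using congrArg (aeval x) (hf.comp_eq c)
  have h2 : (f.map (algebraMap k L)).comp (C x + X) = C (aeval x f) + f.map (algebraMap k L) := by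
    apply Polynomial.eq_of_infinite_eval_eq
    refine (Set.infinite_range_of_injective (algebraMap k L).injective).mono ?_
    rintro _ ⟨c, rfl⟩
    simpa [eval_map_algebraMap] using h1 c
  simpa [eval_map_algebraMap] using congrArg (eval y) h2

/-- The additive endomorphism of an extension field defined by an additive polynomial. -/
def IsAdditive.toAddMonoidHom [Infinite k] (hf : IsAdditive f) (L : Type*) [Field L]
    [Algebra k L] : L →+ L :=
  AddMonoidHom.mk' (fun x => aeval x f) hf.aeval_add

lemma IsAdditive.derivative_eq [Infinite k] (hf : IsAdditive f) :
    derivative f = C ((derivative f).eval 0) := by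
  refine Polynomial.funext fun y => ?_
  have := congrArg (fun q => eval 0 (derivative q)) (hf.comp_eq y)
  simpa [derivative_comp] using this

/-- The derivative of a separable additive polynomial is a nonzero constant. -/
lemma IsAdditive.derivative_eval_ne_zero (hf : IsAdditive f) (hsep : f.Separable) :
    (derivative f).eval 0 ≠ 0 := by
  intro h0
  obtain ⟨u, v, huv⟩ := hsep
  have hf0 : f.eval 0 = 0 := by simpa using hf 0 0
  have := congrArg (eval 0) huv
  simp [h0, hf0] at this

variable [IsAlgClosed k]

lemma mem_range_of_isAlgebraic {L : Type*} [Field L] [Algebra k L] {v : L}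
    (hv : IsAlgebraic k v) : v ∈ (algebraMap k L).range :=
  minpoly.mem_range_of_degree_eq_one k v
    (IsAlgClosed.degree_eq_one_of_irreducible k (minpoly.irreducible hv.isIntegral))

/-- Over an algebraically closed field, the preimages of constants under a nonconstant polynomial
are constants. -/
lemma mem_range_of_iterate_mem_range (hdeg : f.natDegree ≠ 0) {L : Type*} [Field L] [Algebra k L]
    (n : ℕ) : ∀ v : L, (fun x => aeval x f)^[n] v ∈ (algebraMap k L).range →
      v ∈ (algebraMap k L).range := by
  induction n with
  | zero => exact fun v hv => hv
  | succ n ih =>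
    intro v hv
    obtain ⟨c, hc⟩ := ih (aeval v f) hv
    refine mem_range_of_isAlgebraic ⟨f - C c, ?_, by simp [hc]⟩
    intro h0
    apply hdeg
    rw [sub_eq_zero.1 h0, natDegree_C]

/-- The fibres of an additive polynomial are torsors under groups of constants, so that the
monodromy acts on the backward orbit by translations by constants. -/
lemma IsAdditive.apply_eq_add (hf : IsAdditive f) (hdeg : f.natDegree ≠ 0)
    (σ : IMG (algebraMap k[X] (RatFunc k) f))
    {x : iterField (algebraMap k[X] (RatFunc k) f)}
    (hx : x ∈ backwardOrbit (algebraMap k[X] (RatFunc k) f)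
      (iterField (algebraMap k[X] (RatFunc k) f))) :
    ∃ c : k, σ x = x + algebraMap k _ c := by
  obtain ⟨n, -, hn⟩ := hx
  have hσn := (map_mem_fiber_iff (algebraMap k[X] (RatFunc k) f)
    (E' := iterField (algebraMap k[X] (RatFunc k) f)) σ.toAlgHom n x).2 hn
  have h1 := (mem_fiber_iff (transcendental_of_mem_fiber hn)).1 hn
  have h2 := (mem_fiber_iff (transcendental_of_mem_fiber hσn)).1 hσn
  have he : (fun y : iterField (algebraMap k[X] (RatFunc k) f) =>
      (algebraMap k[X] (RatFunc k) f).eval (algebraMap k _) y) =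
      hf.toAddMonoidHom (iterField (algebraMap k[X] (RatFunc k) f)) := by
    funext y
    rw [RatFunc.eval_algebraMap]
    rfl
  have h3 : (hf.toAddMonoidHom (iterField (algebraMap k[X] (RatFunc k) f)))^[n] (σ x - x) = 0 := by
    rw [he] at h1 h2
    rw [iterate_map_sub, h1, sub_eq_zero]
    exact h2
  obtain ⟨c, hc⟩ := mem_range_of_iterate_mem_range hdeg n (σ x - x)
    (by
      have h4 : (fun z => aeval z f)^[n] (σ x - x) = 0 := h3
      rw [h4]
      exact zero_mem _)
  exact ⟨c, by rw [hc]; ring⟩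

lemma IsAdditive.img_comm (hf : IsAdditive f) (hdeg : f.natDegree ≠ 0)
    (σ τ : IMG (algebraMap k[X] (RatFunc k) f)) : σ * τ = τ * σ := by
  refine img_ext fun x hx => ?_
  obtain ⟨c, hc⟩ := hf.apply_eq_add hdeg σ hx
  obtain ⟨d, hd⟩ := hf.apply_eq_add hdeg τ hx
  have h1 : ∀ (ρ : IMG (algebraMap k[X] (RatFunc k) f)) (a : k),
      ρ (algebraMap k _ a) = algebraMap k _ a :=
    fun ρ a => (ρ.restrictScalars k).commutes a
  rw [AlgEquiv.mul_apply, AlgEquiv.mul_apply, hc, hd, map_add, map_add, h1, h1, hc, hd]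
  ring

lemma IsAdditive.img_pow (hf : IsAdditive f) (hdeg : f.natDegree ≠ 0) (p : ℕ) [CharP k p]
    (σ : IMG (algebraMap k[X] (RatFunc k) f)) : σ ^ p = 1 := by
  refine img_ext fun x hx => ?_
  obtain ⟨c, hc⟩ := hf.apply_eq_add hdeg σ hx
  have h1 : ∀ n : ℕ, (σ ^ n) x = x + algebraMap k _ (n * c) := by
    intro n
    induction n with
    | zero => simp
    | succ n ih =>
      rw [pow_succ', AlgEquiv.mul_apply, ih, map_add, hc,
        show σ (algebraMap k _ (n * c)) = algebraMap k _ (n * c) from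
          (σ.restrictScalars k).commutes _, add_assoc, ← map_add]
      congr 2
      push_cast
      ring
  rw [h1, CharP.cast_eq_zero, zero_mul, map_zero, add_zero, AlgEquiv.one_apply]

/-- A point `x` with `f(x) = t` is separable over `k(t)` but does not lie in `k(t)`, and hence is
moved by the monodromy. -/
lemma IsAdditive.exists_img_ne_one (hf : IsAdditive f) (hsep : f.Separable)
    (hdeg : 2 ≤ f.natDegree) : ∃ σ : IMG (algebraMap k[X] (RatFunc k) f), σ ≠ 1 := by
  set h := algebraMap k[X] (RatFunc k) f with hh
  have hmd : mapDegree h = f.natDegree := by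
    simp [mapDegree, hh, RatFunc.num_algebraMap, RatFunc.denom_algebraMap]
  obtain ⟨x, hx⟩ := exists_eval_eq (h := h) (by omega)
    (transcendental_param (F := k) (L := AlgebraicClosure (RatFunc k)))
  have hxt : Transcendental k x := transcendental_of_eval (g := h) (hx ▸ transcendental_param)
  have hxf : x ∈ fiber h (AlgebraicClosure (RatFunc k)) 1 := (mem_fiber_iff hxt).2 hx
  have hxE : x ∈ iterField h := subset_adjoin _ _ ⟨1, le_rfl, hxf⟩
  set y : iterField h := ⟨x, hxE⟩ with hy
  have hyf : y ∈ fiber h (iterField h) 1 := (map_mem_fiber_iff h (iterField h).val 1 y).1 hxf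
  have hyt := transcendental_of_mem_fiber hyf
  have hyeval : evalHom y hyt h = param k (iterField h) := by
    rw [evalHom_apply]
    exact (mem_fiber_iff hyt).1 hyf
  have hnot : y ∉ (⊥ : Subalgebra (RatFunc k) (iterField h)) := by
    intro hbot
    obtain ⟨g, hg⟩ := Algebra.mem_bot.1 hbot
    have h1 : y ∈ k⟮evalHom y hyt h⟯ := by
      rw [hyeval]
      have h2 := algebraMap_mem_adjoin_param (F := k) (L := iterField h) g
      rwa [hg] at h2
    rw [mem_adjoin_evalHom_iff] at h1
    omega
  have hsepy : IsSeparable (RatFunc k) y := by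
    have hroot : aeval y (f.map (algebraMap k (RatFunc k)) - C RatFunc.X) = 0 := by
      rw [map_sub, aeval_map_algebraMap, aeval_C, sub_eq_zero]
      rw [evalHom_apply] at hyeval
      exact (RatFunc.eval_algebraMap (f := algebraMap k (iterField h)) (a := y) f).symm.trans
        hyeval
    refine Separable.of_dvd ?_ (minpoly.dvd _ _ hroot)
    have hu : algebraMap k (RatFunc k) ((derivative f).eval 0) ≠ 0 :=
      (_root_.map_ne_zero _).2 (hf.derivative_eval_ne_zero hsep)
    rw [separable_def, derivative_sub, derivative_C, sub_zero, derivative_map, hf.derivative_eq,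
      map_C]
    exact ⟨0, C (algebraMap k (RatFunc k) ((derivative f).eval 0))⁻¹, by
      rw [zero_mul, zero_add, ← C_mul, inv_mul_cancel₀ hu, C_1]⟩
  obtain ⟨z, hz, hconj⟩ := (notMem_iff_exists_ne_and_isConjRoot hsepy
    (Normal.splits inferInstance y)).1 hnot
  obtain ⟨σ, hσ⟩ := isConjRoot_iff_exists_algEquiv.1 hconj.symm
  refine ⟨σ, ?_⟩
  rintro rfl
  exact hz hσ

end Additive

end IterMonodromy

end

theorem mainTheorem2 {p : ℕ} [Fact p.Prime] {k : Type*} [Field k] [Algebra (ZMod p) k]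
    [IsAlgClosure (ZMod p) k] (f : k[X]) (hadd : IterMonodromy.IsAdditive f)
    (hsep : f.Separable) (hdeg : 2 ≤ f.natDegree)
    {R : Type*} [CommRing R] [IsDomain R] [IsDiscreteValuationRing R] [CharZero R]
    (π : R →+* k) {K : Type*} [Field K] [Algebra R K] [IsFractionRing R K] :
    ¬ ∃ h : RatFunc K, IterMonodromy.IsLift π (algebraMap k[X] (RatFunc k) f) h ∧
      IterMonodromy.ActionsEquivalent
        (IterMonodromy.IMG (IterMonodromy.toClosure h))
        (IterMonodromy.Orbit (IterMonodromy.toClosure h))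
        (IterMonodromy.IMG (algebraMap k[X] (RatFunc k) f))
        (IterMonodromy.Orbit (algebraMap k[X] (RatFunc k) f)) := by
  rintro ⟨h, -, φ, -, -⟩
  have : IsAlgClosed k := IsAlgClosure.isAlgClosed (ZMod p)
  have : CharP k p := charP_of_injective_algebraMap (algebraMap (ZMod p) k).injective p
  have : CharZero K := charZero_of_injective_algebraMap (IsFractionRing.injective R K)
  have hle : IterMonodromy.mapDegree (IterMonodromy.toClosure h) ≤ 1 :=
    IterMonodromy.mapDegree_le_one (Fact.out : p.Prime).ne_zero
      (fun σ τ => φ.injective (by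
        rw [map_mul, map_mul, hadd.img_comm (by omega)]))
      (fun σ => φ.injective (by rw [map_pow, map_one, hadd.img_pow (by omega) p]))
  obtain ⟨σ, hσ⟩ := hadd.exists_img_ne_one hsep hdeg
  apply hσ
  rw [← φ.apply_symm_apply σ, IterMonodromy.img_eq_one hle (φ.symm σ), map_one]
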